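/- Let $x_1,x_2,\dots$ be i.i.d. random vectors in $\mathbb R^p$ with the normal law $N(\mu,\Sigma)$, where $\Sigma$ is positive semidefinite with positive diagonal entries (it may be singular), and let $r\in\mathbb R$ be the risk-free rate. Put $\sigma_i=\sqrt{\Sigma_{ii}}$ and $R=\operatorname{diag}(\sigma)^{-1}\,\Sigma\,\operatorname{diag}(\sigma)^{-1}$ (the correlation matrix). Let $\mu_i=E[x_{1,i}]$ and $m_{2,i}=E[x_{1,i}^2]$, and let $\zeta\in\mathbb R^p$ be the vector of signal-to-noise ratios $$\zeta_i=\frac{\mu_i-r}{\sqrt{m_{2,i}-\mu_i^2}}=\frac{\mu_i-r}{\sigma_i}.$$ For each $n$ let $\hat\mu_i=\frac1n\sum_{t=1}^n x_{t,i}$ and $\hat m_{2,i}=\frac1n\sum_{t=1}^n x_{t,i}^2$, and let $\hat\zeta^{(n)}$ be the vector of sample Sharpe ratios $$\hat\zeta^{(n)}_i=\frac{\hat\mu_i-r}{\sqrt{\hat m_{2,i}-\hat\mu_i^2}}.$$ Then the matrix $$V=R+\tfrac12\operatorname{diag}(\zeta)\,(R\circ R)\,\operatorname{diag}(\zeta)$$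 (where $\circ$ is the entrywise product) is positive semidefinite, and $\hat\zeta^{(n)}$ is asymptotically normal with mean $\zeta$ and covariance $\frac1n V$, that is, $$\sqrt n\,\bigl(\hat\zeta^{(n)}-\zeta\bigr)\ \rightsquigarrow\ N(0,V)\qquad(n\to\infty)$$ in distribution. If $p=1$, then the asymptotic standard error, the square root of the single entry of $\frac1n V$, equals $\sqrt{(1+\zeta^2/2)/n}$, and $\sqrt n(\hat\zeta^{(n)}-\zeta)\rightsquigarrow N(0,\,1+\zeta^2/2)$. -/

import Mathlib

open MeasureTheory ProbabilityTheory Filter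
open scoped Matrix

noncomputable section

/-- Sample mean `(1/n) ∑_{t < n} x_t` of the first `n` terms of a real sequence. -/
def sampleMean (x : ℕ → ℝ) (n : ℕ) : ℝ :=
  (1 / (n : ℝ)) * ∑ t ∈ Finset.range n, x t

/-- Sample (uncentered) second moment `(1/n) ∑_{t < n} x_t ^ 2`. -/
def sampleSecondMoment (x : ℕ → ℝ) (n : ℕ) : ℝ :=
  (1 / (n : ℝ)) * ∑ t ∈ Finset.range n, x t ^ 2

/-- Vector of sample Sharpe ratios, with risk free rate `r`, of the first `n` observations of a
sequence of return vectors. -/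
def sampleSharpe {p : ℕ} (r : ℝ) (x : ℕ → EuclideanSpace ℝ (Fin p)) (n : ℕ) :
    EuclideanSpace ℝ (Fin p) :=
  WithLp.toLp 2 fun i =>
    (sampleMean (fun t => x t i) n - r) /
      √(sampleSecondMoment (fun t => x t i) n - sampleMean (fun t => x t i) n ^ 2)

/-- Vector of population signal-to-noise ratios, with risk free rate `r`, of the law `ν` of a
return vector: the population analogue of the vector of sample Sharpe ratios. -/
def signalNoise {p : ℕ} (r : ℝ) (ν : Measure (EuclideanSpace ℝ (Fin p))) :
    EuclideanSpace ℝ (Fin p) :=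
  WithLp.toLp 2 fun i =>
    ((∫ x, x i ∂ν) - r) / √((∫ x, x i ^ 2 ∂ν) - (∫ x, x i ∂ν) ^ 2)

/-- Correlation matrix `diag(σ⁻¹) S diag(σ⁻¹)` of a covariance matrix `S`, where `σ` is the
vector of square roots of the diagonal entries of `S`. -/
def correlationMatrix {p : ℕ} (S : Matrix (Fin p) (Fin p) ℝ) : Matrix (Fin p) (Fin p) ℝ :=
  Matrix.diagonal (fun i => (√(S i i))⁻¹) * S * Matrix.diagonal (fun i => (√(S i i))⁻¹)

/-- The matrix `R + ½ diag(ζ) (R ∘ R) diag(ζ)`, with `∘` the Hadamard product. -/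
def sharpeCovariance {p : ℕ} (R : Matrix (Fin p) (Fin p) ℝ) (ζ : EuclideanSpace ℝ (Fin p)) :
    Matrix (Fin p) (Fin p) ℝ :=
  R + (1 / 2 : ℝ) • (Matrix.diagonal (fun i => ζ i) * (R ⊙ R) * Matrix.diagonal (fun i => ζ i))

end

/-!
Write `Z_i = (x_i - μ_i) / σ_i` for the standardized coordinates, `a_i` and `b_i` for the sample means
of `Z_i` and `Z_i ^ 2`, and `v_i = b_i - a_i ^ 2`. The sample Sharpe ratio of coordinate `i` is
`(ζ_i + a_i) / √v_i` (`sampleSharpe_apply_of_standardize`). Let `q` be the divided difference of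
`h x = (√x)⁻¹` between `1` and `v`, so that `h v = 1 + (v - 1) q` holds for every `v`, including
`v = 0`. With `A = √n a` and `B = √n (b - 1)` this gives the exact identity

`√n ((ζ + a) / √v - ζ) = A (h v - ζ a q) + B ζ q`.

By the strong law `a → 0` and `v → 1` almost surely, hence `h v → 1` and `q → h' 1 = -1/2`, while `A`
and `B` converge in distribution. By Slutsky's theorem the left side is `A - ζ B / 2` up to a term
tending to `0` in probability (`tendstoInMeasure_sharpe_sub_influence`). Thus the Sharpe ratio is
asymptotically a normalized sum of the influence function `Z - ζ (Z ^ 2 - 1) / 2`.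

The vector of these sums converges in distribution by a multivariate central limit theorem
(`tendstoInDistribution_inv_sqrt_smul_sum`), deduced from the one-dimensional one by Lévy's theorem.
Its covariance is computed from the moments of a centred Gaussian pair with unit variances and
correlation `ρ`: the mixed third moments vanish and `E[U² V²] = 1 + 2 ρ²`, so that two influence
functions have covariance `ρ + ζ_i ζ_j ρ² / 2` (`covariance_influence`), which is the `(i, j)` entry
of `V`. These mixed moments come by polarization from the third and fourth moments of one real
Gaussian variable. Positive semidefiniteness of `V` is the Schur product theorem, and the
one-dimensional statement is the image of the vector statement under a coordinate projection.
-/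

/-! ### Third and fourth moments of Gaussian variables and pairs -/

namespace ProbabilityTheory

section GaussianMoments
open scoped NNReal

lemma integrable_pow_of_hasLaw_gaussianReal {Ω : Type*} [MeasurableSpace Ω] {P : Measure Ω}
    {X : Ω → ℝ} {m : ℝ} {v : ℝ≥0} (hX : HasLaw X (gaussianReal m v) P) (k : ℕ) :
    Integrable (fun ω => X ω ^ k) P := by
  have hprob : IsProbabilityMeasure P := hX.isProbabilityMeasure
  refine integrable_pow_of_mem_interior_integrableExpSet (X := X) (μ := P) ?_ k
  have : integrableExpSet X P = Set.univ := by
    ext t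
    simp only [integrableExpSet, Set.mem_ofPred_eq, Set.mem_univ, iff_true]
    rw [← mgf_pos_iff, mgf_gaussianReal hX.map_eq]
    exact Real.exp_pos _
  simp [this]

lemma integral_pow_three_gaussianReal (v : ℝ≥0) : ∫ x, x ^ 3 ∂gaussianReal 0 v = 0 := by
  have h : ∫ x, x ^ 3 ∂gaussianReal 0 v = ∫ x, (-x) ^ 3 ∂gaussianReal 0 v := by
    conv_lhs => rw [← neg_zero, ← gaussianReal_map_neg]
    rw [integral_map (by fun_prop) (by fun_prop)]
  have h' : ∫ x, (-x) ^ 3 ∂gaussianReal 0 v = -∫ x, x ^ 3 ∂gaussianReal 0 v := by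
    rw [← integral_neg]
    congr with x
    ring
  linarith

lemma integral_pow_four_gaussianReal (v : ℝ≥0) :
    ∫ x, x ^ 4 ∂gaussianReal 0 v = 3 * (v : ℝ) ^ 2 := by
  -- differentiation acts on polynomial multiples of the moment generating function
  have hd (a b c d e : ℝ) : deriv (fun t : ℝ => (a + b * t + c * t ^ 2 + d * t ^ 3 + e * t ^ 4) *
      Real.exp (v * t ^ 2 / 2)) = fun t => (b + 2 * c * t + 3 * d * t ^ 2 + 4 * e * t ^ 3 +
        (a + b * t + c * t ^ 2 + d * t ^ 3 + e * t ^ 4) * (v * t)) * Real.exp (v * t ^ 2 / 2) := by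
    ext t
    have h1 : HasDerivAt (fun t : ℝ => a + b * t + c * t ^ 2 + d * t ^ 3 + e * t ^ 4)
        (b + 2 * c * t + 3 * d * t ^ 2 + 4 * e * t ^ 3) t := by
      have := ((((hasDerivAt_const t a).add ((hasDerivAt_id t).const_mul b)).add
        ((hasDerivAt_pow 2 t).const_mul c)).add ((hasDerivAt_pow 3 t).const_mul d)).add
        ((hasDerivAt_pow 4 t).const_mul e)
      refine this.congr_deriv ?_
      norm_num
      ring
    have h2 : HasDerivAt (fun t : ℝ => Real.exp (v * t ^ 2 / 2))
        (Real.exp (v * t ^ 2 / 2) * (v * t)) t := by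
      have := (((hasDerivAt_pow 2 t).const_mul (v : ℝ)).div_const 2).exp
      refine this.congr_deriv ?_
      norm_num
      ring
    rw [(h1.fun_mul h2).deriv]
    ring
  calc ∫ x, x ^ 4 ∂gaussianReal 0 v
      = iteratedDeriv 4 (mgf (fun x ↦ x) (gaussianReal 0 v)) 0 := by
        rw [iteratedDeriv_mgf_zero] <;> simp
    _ = 3 * (v : ℝ) ^ 2 := by
        have e0 : (fun t : ℝ => Real.exp (0 * t + v * t ^ 2 / 2)) =
            fun t => (1 + 0 * t + 0 * t ^ 2 + 0 * t ^ 3 + 0 * t ^ 4) *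
              Real.exp (v * t ^ 2 / 2) := by
          ext t; simp
        have e1 : deriv (fun t : ℝ => Real.exp (0 * t + v * t ^ 2 / 2)) =
            fun t => (0 + v * t + 0 * t ^ 2 + 0 * t ^ 3 + 0 * t ^ 4) *
              Real.exp (v * t ^ 2 / 2) := by
          rw [e0, hd]; ext t; ring
        have e2 : deriv (deriv (fun t : ℝ => Real.exp (0 * t + v * t ^ 2 / 2))) =
            fun t => (v + 0 * t + v ^ 2 * t ^ 2 + 0 * t ^ 3 + 0 * t ^ 4) *
              Real.exp (v * t ^ 2 / 2) := by
          rw [e1, hd]; ext t; ring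
        have e3 : deriv (deriv (deriv (fun t : ℝ => Real.exp (0 * t + v * t ^ 2 / 2)))) =
            fun t => (0 + 3 * v ^ 2 * t + 0 * t ^ 2 + v ^ 3 * t ^ 3 + 0 * t ^ 4) *
              Real.exp (v * t ^ 2 / 2) := by
          rw [e2, hd]; ext t; ring
        rw [mgf_fun_id_gaussianReal, iteratedDeriv_succ, iteratedDeriv_succ, iteratedDeriv_succ,
          iteratedDeriv_one, e3, hd]
        simp

end GaussianMoments

section Isserlis

variable {Ω : Type*} [MeasurableSpace Ω] {P : Measure Ω} {U V : Ω → ℝ}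

lemma hasLaw_gaussianReal_of_hasGaussianLaw (hU : HasGaussianLaw U P) (h0 : ∫ ω, U ω ∂P = 0) :
    HasLaw U (gaussianReal 0 (∫ ω, U ω ^ 2 ∂P).toNNReal) P where
  aemeasurable := hU.aemeasurable
  map_eq := by
    rw [hU.map_eq_gaussianReal, variance_of_integral_eq_zero hU.aemeasurable h0, h0]

lemma HasGaussianLaw.integrable_pow (hU : HasGaussianLaw U P) (k : ℕ) :
    Integrable (fun ω => U ω ^ k) P :=
  integrable_pow_of_hasLaw_gaussianReal ⟨hU.aemeasurable, hU.map_eq_gaussianReal⟩ k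

lemma HasGaussianLaw.integral_pow_three (hU : HasGaussianLaw U P) (h0 : ∫ ω, U ω ∂P = 0) :
    ∫ ω, U ω ^ 3 ∂P = 0 := by
  rw [← integral_pow_three_gaussianReal (∫ ω, U ω ^ 2 ∂P).toNNReal]
  exact (hasLaw_gaussianReal_of_hasGaussianLaw hU h0).integral_comp (f := fun x => x ^ 3)
    (by fun_prop)

lemma HasGaussianLaw.integral_pow_four (hU : HasGaussianLaw U P) (h0 : ∫ ω, U ω ∂P = 0) :
    ∫ ω, U ω ^ 4 ∂P = 3 * (∫ ω, U ω ^ 2 ∂P) ^ 2 := by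
  have h := integral_pow_four_gaussianReal (∫ ω, U ω ^ 2 ∂P).toNNReal
  rw [Real.coe_toNNReal _ (integral_nonneg fun ω => sq_nonneg _)] at h
  rw [← h]
  exact (hasLaw_gaussianReal_of_hasGaussianLaw hU h0).integral_comp (f := fun x => x ^ 4)
    (by fun_prop)

lemma HasGaussianLaw.integrable_mul (h : HasGaussianLaw (fun ω => (U ω, V ω)) P) :
    Integrable (fun ω => U ω * V ω) P := by
  refine (((h.fun_add.integrable_pow 2).sub (h.fun_sub.integrable_pow 2)).const_mul
    (1 / 4)).congr (ae_of_all _ fun ω => ?_)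
  simp only [Pi.sub_apply]
  ring

lemma HasGaussianLaw.integrable_sq_mul (h : HasGaussianLaw (fun ω => (U ω, V ω)) P) :
    Integrable (fun ω => U ω ^ 2 * V ω) P := by
  refine ((((h.fun_add.integrable_pow 3).sub (h.fun_sub.integrable_pow 3)).sub
    ((h.snd.integrable_pow 3).const_mul 2)).const_mul (1 / 6)).congr (ae_of_all _ fun ω => ?_)
  simp only [Pi.sub_apply]
  ring

lemma HasGaussianLaw.integrable_sq_mul_sq (h : HasGaussianLaw (fun ω => (U ω, V ω)) P) :
    Integrable (fun ω => U ω ^ 2 * V ω ^ 2) P := by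
  refine ((((h.fun_add.integrable_pow 4).add (h.fun_sub.integrable_pow 4)).sub
    (((h.fst.integrable_pow 4).add (h.snd.integrable_pow 4)).const_mul 2)).const_mul
      (1 / 12)).congr (ae_of_all _ fun ω => ?_)
  simp only [Pi.sub_apply, Pi.add_apply]
  ring

/-- Odd case of Isserlis' theorem for a centred Gaussian pair, by polarization from the vanishing
third moments of `U + V`, `U - V` and `V`. -/
lemma HasGaussianLaw.integral_sq_mul (h : HasGaussianLaw (fun ω => (U ω, V ω)) P)
    (hU : ∫ ω, U ω ∂P = 0) (hV : ∫ ω, V ω ∂P = 0) : ∫ ω, U ω ^ 2 * V ω ∂P = 0 := by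
  have hadd : ∫ ω, (U ω + V ω) ∂P = 0 := by
    rw [integral_add h.fst.integrable h.snd.integrable, hU, hV, add_zero]
  have hsub : ∫ ω, (U ω - V ω) ∂P = 0 := by
    rw [integral_sub h.fst.integrable h.snd.integrable, hU, hV, sub_zero]
  have key : ∫ ω, (U ω + V ω) ^ 3 ∂P =
      ∫ ω, ((U ω - V ω) ^ 3 + 2 * V ω ^ 3 + 6 * (U ω ^ 2 * V ω)) ∂P := by
    congr with ω
    ring
  rw [integral_add ((h.fun_sub.integrable_pow 3).fun_add ((h.snd.integrable_pow 3).const_mul 2))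
      (h.integrable_sq_mul.const_mul 6),
    integral_add (h.fun_sub.integrable_pow 3) ((h.snd.integrable_pow 3).const_mul 2),
    integral_const_mul, integral_const_mul, h.fun_add.integral_pow_three hadd,
    h.fun_sub.integral_pow_three hsub, h.snd.integral_pow_three hV] at key
  linarith

/-- Fourth-order Isserlis' theorem for a centred Gaussian pair, by polarization from the fourth
moments of `U + V`, `U - V`, `U` and `V`. -/
lemma HasGaussianLaw.integral_sq_mul_sq (h : HasGaussianLaw (fun ω => (U ω, V ω)) P)
    (hU : ∫ ω, U ω ∂P = 0) (hV : ∫ ω, V ω ∂P = 0) :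
    ∫ ω, U ω ^ 2 * V ω ^ 2 ∂P =
      (∫ ω, U ω ^ 2 ∂P) * (∫ ω, V ω ^ 2 ∂P) + 2 * (∫ ω, U ω * V ω ∂P) ^ 2 := by
  have hadd : ∫ ω, (U ω + V ω) ∂P = 0 := by
    rw [integral_add h.fst.integrable h.snd.integrable, hU, hV, add_zero]
  have hsub : ∫ ω, (U ω - V ω) ∂P = 0 := by
    rw [integral_sub h.fst.integrable h.snd.integrable, hU, hV, sub_zero]
  have iU := h.fst.integrable_pow 2
  have iV := h.snd.integrable_pow 2
  have iUV := h.integrable_mul.const_mul 2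
  have sadd : ∫ ω, (U ω + V ω) ^ 2 ∂P =
      ∫ ω, U ω ^ 2 ∂P + ∫ ω, V ω ^ 2 ∂P + 2 * ∫ ω, U ω * V ω ∂P := by
    rw [← integral_const_mul, ← integral_add iU iV, ← integral_add (iU.fun_add iV) iUV]
    congr with ω
    ring
  have ssub : ∫ ω, (U ω - V ω) ^ 2 ∂P =
      ∫ ω, U ω ^ 2 ∂P + ∫ ω, V ω ^ 2 ∂P - 2 * ∫ ω, U ω * V ω ∂P := by
    rw [← integral_const_mul, ← integral_add iU iV, ← integral_sub (iU.fun_add iV) iUV]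
    congr with ω
    ring
  have key : ∫ ω, ((U ω + V ω) ^ 4 + (U ω - V ω) ^ 4) ∂P =
      ∫ ω, ((2 * U ω ^ 4 + 2 * V ω ^ 4) + 12 * (U ω ^ 2 * V ω ^ 2)) ∂P := by
    congr with ω
    ring
  rw [integral_add (h.fun_add.integrable_pow 4) (h.fun_sub.integrable_pow 4),
    integral_add (((h.fst.integrable_pow 4).const_mul 2).fun_add
      ((h.snd.integrable_pow 4).const_mul 2))
      (h.integrable_sq_mul_sq.const_mul 12),
    integral_add ((h.fst.integrable_pow 4).const_mul 2) ((h.snd.integrable_pow 4).const_mul 2),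
    integral_const_mul, integral_const_mul, integral_const_mul,
    h.fun_add.integral_pow_four hadd, h.fun_sub.integral_pow_four hsub,
    h.fst.integral_pow_four hU, h.snd.integral_pow_four hV, sadd, ssub] at key
  linear_combination (-1 / 12) * key

end Isserlis

end ProbabilityTheory

/-! ### Convergence in distribution and the multivariate central limit theorem -/

section Convergence
open scoped Topology

namespace MeasureTheory

/-- Convergence in distribution to a constant implies convergence in probability, by the
portmanteau theorem applied to the closed sets `{x | ε ≤ dist x c}`. -/
lemma TendstoInDistribution.tendstoInMeasure_const {ι Ω Ω' E : Type*} {l : Filter ι}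
    [MeasurableSpace Ω] [MeasurableSpace Ω'] {P : Measure Ω} [IsProbabilityMeasure P]
    {P' : Measure Ω'} [IsProbabilityMeasure P']
    [PseudoMetricSpace E] [MeasurableSpace E] [BorelSpace E] {X : ι → Ω → E} {c : E}
    (h : TendstoInDistribution X l (fun _ : Ω' => c) (fun _ => P) P') :
    TendstoInMeasure P X l (fun _ => c) := by
  rw [tendstoInMeasure_iff_dist]
  intro ε hε
  have hclosed : IsClosed {x : E | ε ≤ dist x c} :=
    isClosed_le continuous_const (continuous_id.dist continuous_const)
  have hlim := ProbabilityMeasure.limsup_measure_closed_le_of_tendsto h.tendsto hclosed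
  have hzero : (P'.map (fun _ => c)) {x : E | ε ≤ dist x c} = 0 := by
    rw [Measure.map_apply measurable_const hclosed.measurableSet]
    simp [hε.not_ge]
  have heq (i : ι) : (P.map (X i)) {x : E | ε ≤ dist x c} = P {ω | ε ≤ dist (X i ω) c} := by
    rw [Measure.map_apply_of_aemeasurable (h.forall_aemeasurable i) hclosed.measurableSet]
    rfl
  simp only [ProbabilityMeasure.coe_mk, hzero, heq] at hlim
  exact tendsto_of_le_liminf_of_limsup_le zero_le hlim

/-- A sequence converging in distribution times one converging to `0` in probability converges to
`0` in probability. -/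
lemma TendstoInDistribution.mul_tendstoInMeasure_zero {ι Ω Ω' : Type*} {l : Filter ι}
    [l.IsCountablyGenerated] [MeasurableSpace Ω] [MeasurableSpace Ω'] {P : Measure Ω}
    [IsProbabilityMeasure P] {P' : Measure Ω'} [IsProbabilityMeasure P']
    {X K : ι → Ω → ℝ} {Z : Ω' → ℝ} (hX : TendstoInDistribution X l Z (fun _ => P) P')
    (hK : TendstoInMeasure P K l (fun _ => 0)) (hKm : ∀ i, AEMeasurable (K i) P) :
    TendstoInMeasure P (fun i ω => X i ω * K i ω) l (fun _ => 0) := by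
  have h := hX.continuous_comp_prodMk_of_tendstoInMeasure_const
    (g := fun x : ℝ × ℝ => x.1 * x.2) (by fun_prop) hK hKm
  simp only [mul_zero] at h
  exact h.tendstoInMeasure_const

/-- Sums of real sequences tending to `0` in probability tend to `0` in probability. -/
lemma TendstoInMeasure.add_of_zero {ι Ω : Type*} {l : Filter ι} [l.IsCountablyGenerated] [l.NeBot]
    [MeasurableSpace Ω] {P : Measure Ω} [IsProbabilityMeasure P] {X Y : ι → Ω → ℝ}
    (hX : TendstoInMeasure P X l (fun _ => 0)) (hY : TendstoInMeasure P Y l (fun _ => 0))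
    (hXm : ∀ i, AEMeasurable (X i) P) (hYm : ∀ i, AEMeasurable (Y i) P) :
    TendstoInMeasure P (fun i ω => X i ω + Y i ω) l (fun _ => 0) := by
  have h := (hX.tendstoInDistribution hXm).add_of_tendstoInMeasure_const hY hYm
  simp only [add_zero] at h
  exact h.tendstoInMeasure_const

/-- Convergence in probability in Euclidean space can be checked coordinatewise. -/
lemma tendstoInMeasure_zero_of_forall_apply {ι κ Ω : Type*} [Fintype κ] {l : Filter ι}
    [MeasurableSpace Ω] {P : Measure Ω} {X : ι → Ω → EuclideanSpace ℝ κ}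
    (h : ∀ k, TendstoInMeasure P (fun i ω => X i ω k) l (fun _ => 0)) :
    TendstoInMeasure P X l 0 := by
  rw [tendstoInMeasure_iff_norm]
  intro ε hε
  -- if all coordinates are below this threshold, the norm is below `ε`
  have hδ : 0 < ε / (Fintype.card κ + 1) := by positivity
  have hsum := tendsto_finsetSum (Finset.univ : Finset κ)
    (fun k _ => tendstoInMeasure_iff_norm.1 (h k) _ hδ)
  rw [Finset.sum_const_zero] at hsum
  refine tendsto_of_tendsto_of_tendsto_of_le_of_le tendsto_const_nhds hsum
    (fun _ => zero_le) fun i => ?_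
  refine (measure_mono fun ω hω => ?_).trans
    (measure_biUnion_finset_le Finset.univ _)
  by_contra hcon
  simp only [Set.mem_iUnion, Finset.mem_univ, exists_prop, true_and, not_exists] at hcon
  have hlt (k : κ) : ‖X i ω k‖ < ε / (Fintype.card κ + 1) := by
    simpa using hcon k
  have hle : ‖X i ω‖ ≤ ∑ k, ‖X i ω k‖ := by
    rw [EuclideanSpace.norm_eq]
    refine Real.sqrt_le_iff.2 ⟨Finset.sum_nonneg fun _ _ => norm_nonneg _, ?_⟩
    exact Finset.sum_sq_le_sq_sum_of_nonneg fun _ _ => norm_nonneg _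
  have hle' : ∑ k, ‖X i ω k‖ ≤ Fintype.card κ * (ε / (Fintype.card κ + 1)) := by
    refine (Finset.sum_le_card_nsmul _ _ _ fun k _ => (hlt k).le).trans_eq ?_
    simp
  have hfin : Fintype.card κ * (ε / (Fintype.card κ + 1)) < ε := by
    rw [mul_div_assoc', div_lt_iff₀ (by positivity)]
    linarith
  have : ε ≤ ‖X i ω‖ := by simpa using hω
  linarith

/-- Convergence in distribution only depends on the law of the limit. -/
lemma TendstoInDistribution.congr_limit {ι Ω Ω₁ Ω₂ E : Type*} {l : Filter ι} [MeasurableSpace Ω]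
    [MeasurableSpace Ω₁] [MeasurableSpace Ω₂] {P : Measure Ω} [IsProbabilityMeasure P]
    {P₁ : Measure Ω₁} [IsProbabilityMeasure P₁] {P₂ : Measure Ω₂} [IsProbabilityMeasure P₂]
    [TopologicalSpace E] [MeasurableSpace E] [OpensMeasurableSpace E] {X : ι → Ω → E}
    {Z : Ω₁ → E} {T : Ω₂ → E} (h : TendstoInDistribution X l Z (fun _ => P) P₁)
    (hZT : IdentDistrib Z T P₁ P₂) : TendstoInDistribution X l T (fun _ => P) P₂ where
  forall_aemeasurable := h.forall_aemeasurable
  aemeasurable_limit := hZT.aemeasurable_snd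
  tendsto := by
    convert h.tendsto using 2
    exact congrArg 𝓝 (Subtype.ext hZT.map_eq.symm)

end MeasureTheory

namespace ProbabilityTheory
open scoped RealInnerProductSpace

lemma charFun_map_eq_charFun_map_inner {Ω E : Type*} [MeasurableSpace Ω] {P : Measure Ω}
    [NormedAddCommGroup E] [InnerProductSpace ℝ E] [MeasurableSpace E] [BorelSpace E]
    [SecondCountableTopology E] {X : Ω → E} (hX : AEMeasurable X P) (t : E) :
    charFun (P.map X) t = charFun (P.map fun ω => ⟪X ω, t⟫) 1 := by
  rw [charFun_apply, charFun_apply, integral_map hX (by fun_prop),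
    integral_map (by fun_prop) (by fun_prop)]
  simp

/-- **Multivariate central limit theorem** for centred i.i.d. random vectors with finite second
moments. By Lévy's theorem it suffices to treat the characteristic functions, and at `t` these only
depend on the one-dimensional projections on `t` (the Cramér–Wold device). -/
theorem tendstoInDistribution_inv_sqrt_smul_sum {Ω ι : Type*} [MeasurableSpace Ω] {P : Measure Ω}
    [IsProbabilityMeasure P] [Fintype ι] [DecidableEq ι] {Y : ℕ → Ω → EuclideanSpace ℝ ι}
    {C : Matrix ι ι ℝ} (hC : C.PosSemidef) (hL2 : ∀ i, MemLp (fun ω => Y 0 ω i) 2 P)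
    (h0 : ∀ i, ∫ ω, Y 0 ω i ∂P = 0)
    (hcov : ∀ i j, cov[fun ω => Y 0 ω i, fun ω => Y 0 ω j; P] = C i j)
    (hindep : iIndepFun Y P) (hident : ∀ k, IdentDistrib (Y k) (Y 0) P P) :
    TendstoInDistribution (fun (n : ℕ) ω => (√(n : ℝ))⁻¹ • ∑ k ∈ Finset.range n, Y k ω) atTop id
      (fun _ => P) (multivariateGaussian 0 C) := by
  have hm (k : ℕ) := (hident k).aemeasurable_fst
  have hsum (n : ℕ) : AEMeasurable (fun ω => (√(n : ℝ))⁻¹ • ∑ k ∈ Finset.range n, Y k ω) P :=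
    (Finset.aemeasurable_fun_sum _ fun k _ => hm k).fun_const_smul (√(n : ℝ))⁻¹
  refine ⟨hsum, aemeasurable_id, ?_⟩
  refine ProbabilityMeasure.tendsto_iff_tendsto_charFun.2 fun t => ?_
  have hinner (k : ℕ) (ω : Ω) : ⟪Y k ω, t⟫ = ∑ i, t i * Y k ω i := by
    simp [PiLp.inner_apply]
  have hmem : MemLp (fun ω => ⟪Y 0 ω, t⟫) 2 P := by
    simp_rw [hinner]
    exact memLp_finsetSum _ fun i _ => (hL2 i).const_mul (t i)
  have hmean : ∫ ω, ⟪Y 0 ω, t⟫ ∂P = 0 := by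
    simp_rw [hinner]
    rw [integral_finsetSum _ fun i _ => ((hL2 i).integrable one_le_two).const_mul (t i)]
    simp [integral_const_mul, h0]
  have hvar : Var[fun ω => ⟪Y 0 ω, t⟫; P] = t ⬝ᵥ C *ᵥ t := by
    rw [← covariance_self hmem.aemeasurable]
    simp_rw [hinner]
    rw [covariance_fun_sum_fun_sum (fun i => (hL2 i).const_mul (t i))
      (fun i => (hL2 i).const_mul (t i))]
    simp only [covariance_const_mul_left, covariance_const_mul_right, hcov, dotProduct,
      Matrix.mulVec, Finset.mul_sum]
    refine Finset.sum_congr rfl fun i _ => Finset.sum_congr rfl fun j _ => ?_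
    ring
  have hclt := tendstoInDistribution_inv_sqrt_mul_sum_sub (P := P)
    (X := fun k ω => ⟪Y k ω, t⟫) (HasLaw.id (μ := gaussianReal 0 _)) hmem
    (hindep.comp (fun _ x => ⟪x, t⟫) fun _ => by fun_prop)
    (fun k => (hident k).comp (u := fun x => ⟪x, t⟫) (by fun_prop))
  have hlim := ProbabilityMeasure.tendsto_iff_tendsto_charFun.1 hclt.tendsto 1
  have hvnn : 0 ≤ t ⬝ᵥ C *ᵥ t := by simpa using hC.dotProduct_mulVec_nonneg t
  simp only [ProbabilityMeasure.coe_mk, Measure.map_id, hmean, hvar, charFun_gaussianReal,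
    mul_zero, sub_zero] at hlim
  simp only [ProbabilityMeasure.coe_mk, Measure.map_id, charFun_multivariateGaussian hC]
  convert hlim using 2 with n
  · rw [charFun_map_eq_charFun_map_inner (hsum n)]
    simp [inner_smul_left, sum_inner]
  · simp [Real.coe_toNNReal _ hvnn]

end ProbabilityTheory

end Convergence

/-! ### Asymptotic linearity of the sample Sharpe ratio -/

section Linearization
open scoped Topology

variable {Ω : Type*} [MeasurableSpace Ω] {P : Measure Ω}

lemma hasDerivAt_inv_sqrt_one : HasDerivAt (fun x : ℝ => (√x)⁻¹) (-1 / 2) 1 := by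
  have h := (Real.hasDerivAt_sqrt (one_ne_zero (α := ℝ))).inv (by simp)
  refine h.congr_deriv ?_
  norm_num

lemma measurable_dslope {f : ℝ → ℝ} (hf : Measurable f) (a : ℝ) : Measurable (dslope f a) := by
  have h : dslope f a = fun x => if x = a then deriv f a else (x - a)⁻¹ * (f x - f a) := by
    ext x
    simp [dslope, Function.update_apply, slope_def_module]
  rw [h]
  exact Measurable.ite (measurableSet_singleton a) measurable_const (by fun_prop)

/-- Exact expansion of the studentized mean around `ζ`, with the increment of `x ↦ (√x)⁻¹` from
`1` to the sample variance written as a divided difference. It holds without exception, even when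
the sample variance or the sample size vanishes. -/
lemma sqrt_mul_sharpe_sub_eq (ζ : ℝ) (z : ℕ → ℝ) (n : ℕ) :
    let a := sampleMean z n
    let v := sampleSecondMoment z n - a ^ 2
    let q := dslope (fun x : ℝ => (√x)⁻¹) 1 v
    √(n : ℝ) * ((ζ + a) / √v - ζ) -
        (√(n : ℝ))⁻¹ * ∑ k ∈ Finset.range n, (z k - ζ / 2 * (z k ^ 2 - 1)) =
      ((√(n : ℝ))⁻¹ * ∑ k ∈ Finset.range n, z k) * ((√v)⁻¹ - 1 - ζ * a * q) +
        ((√(n : ℝ))⁻¹ * ∑ k ∈ Finset.range n, (z k ^ 2 - 1)) * (ζ * (q + 1 / 2)) := by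
  intro a v q
  rcases Nat.eq_zero_or_pos n with rfl | hn
  -- both sides carry the factor `√0` or its junk inverse
  · simp
  have hn0 : (n : ℝ) ≠ 0 := by positivity
  have hsq : √(n : ℝ) * √(n : ℝ) = n := Real.mul_self_sqrt n.cast_nonneg
  have hs0 : √(n : ℝ) ≠ 0 := by positivity
  have hA : (√(n : ℝ))⁻¹ * ∑ k ∈ Finset.range n, z k = √(n : ℝ) * a := by
    simp only [a, sampleMean]
    field_simp
    rw [pow_two, hsq, mul_comm]
  have hB : (√(n : ℝ))⁻¹ * ∑ k ∈ Finset.range n, (z k ^ 2 - 1) =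
      √(n : ℝ) * (sampleSecondMoment z n - 1) := by
    simp only [sampleSecondMoment, Finset.sum_sub_distrib, Finset.sum_const, Finset.card_range,
      nsmul_eq_mul, mul_one]
    field_simp
    rw [pow_two, hsq]
  have hlin : (√(n : ℝ))⁻¹ * ∑ k ∈ Finset.range n, (z k - ζ / 2 * (z k ^ 2 - 1)) =
      √(n : ℝ) * a - ζ / 2 * (√(n : ℝ) * (sampleSecondMoment z n - 1)) := by
    rw [Finset.sum_sub_distrib, ← Finset.mul_sum, ← hA, ← hB]
    ring
  have hq : (v - 1) * q = (√v)⁻¹ - 1 := by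
    simpa using sub_smul_dslope (fun x : ℝ => (√x)⁻¹) 1 v
  have hv : sampleSecondMoment z n - 1 = (v - 1) + a ^ 2 := by
    simp only [v]
    ring
  rw [hlin, hA, hB, hv, div_eq_mul_inv]
  linear_combination (-√(n : ℝ) * ζ) * hq

variable [IsProbabilityMeasure P] {Z : ℕ → Ω → ℝ}

/-- **Asymptotic linearity of the sample Sharpe ratio**: for standardized i.i.d. observations with
finite fourth moment, the fluctuation of `(ζ + a) / √(b - a ^ 2)` around `ζ`, where `a` and `b` are
the first two sample moments, is the normalized sum of the influence function
`z - ζ / 2 * (z ^ 2 - 1)` up to a term tending to `0` in probability. -/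
theorem tendstoInMeasure_sharpe_sub_influence (ζ : ℝ) (hindep : iIndepFun Z P)
    (hident : ∀ k, IdentDistrib (Z k) (Z 0) P P) (h2 : MemLp (Z 0) 2 P)
    (h4 : MemLp (fun ω => Z 0 ω ^ 2) 2 P) (hmean : ∫ ω, Z 0 ω ∂P = 0)
    (hsq : ∫ ω, Z 0 ω ^ 2 ∂P = 1) :
    TendstoInMeasure P (fun (n : ℕ) ω =>
      √(n : ℝ) * ((ζ + sampleMean (fun t => Z t ω) n) /
        √(sampleSecondMoment (fun t => Z t ω) n - sampleMean (fun t => Z t ω) n ^ 2) - ζ) -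
      (√(n : ℝ))⁻¹ * ∑ k ∈ Finset.range n, (Z k ω - ζ / 2 * (Z k ω ^ 2 - 1)))
      atTop (fun _ => 0) := by
  have hm (k : ℕ) : AEMeasurable (Z k) P := (hident k).aemeasurable_fst
  have hindep2 : iIndepFun (fun k ω => Z k ω ^ 2) P :=
    hindep.comp (fun _ x => x ^ 2) fun _ => by fun_prop
  have hident2 (k : ℕ) : IdentDistrib (fun ω => Z k ω ^ 2) (fun ω => Z 0 ω ^ 2) P P :=
    (hident k).comp (u := fun x => x ^ 2) (by fun_prop)
  -- central limit theorems for the first two sample moments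
  have hA : TendstoInDistribution (fun (n : ℕ) ω => (√(n : ℝ))⁻¹ * ∑ k ∈ Finset.range n, Z k ω)
      atTop id (fun _ => P) (gaussianReal 0 Var[Z 0; P].toNNReal) := by
    simpa only [hmean, mul_zero, sub_zero] using
      tendstoInDistribution_inv_sqrt_mul_sum_sub HasLaw.id h2 hindep hident
  have hB : TendstoInDistribution
      (fun (n : ℕ) ω => (√(n : ℝ))⁻¹ * ∑ k ∈ Finset.range n, (Z k ω ^ 2 - 1)) atTop id
      (fun _ => P) (gaussianReal 0 Var[fun ω => Z 0 ω ^ 2; P].toNNReal) := by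
    have h := tendstoInDistribution_inv_sqrt_mul_sum_sub HasLaw.id h4 hindep2 hident2
    simpa only [hsq, Finset.sum_sub_distrib, Finset.sum_const, Finset.card_range, nsmul_eq_mul,
      mul_one] using h
  have hma (n : ℕ) : AEMeasurable (fun ω => sampleMean (fun t => Z t ω) n) P :=
    (Finset.aemeasurable_fun_sum _ fun k _ => hm k).const_mul _
  have hmb (n : ℕ) : AEMeasurable (fun ω => sampleSecondMoment (fun t => Z t ω) n) P :=
    (Finset.aemeasurable_fun_sum _ fun k _ => (hm k).pow_const 2).const_mul _
  set f : ℝ → ℝ := fun x => (√x)⁻¹ with hf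
  have hfm : Measurable f := by fun_prop
  have hfd : HasDerivAt f (-1 / 2) 1 := hasDerivAt_inv_sqrt_one
  -- the coefficients of the exact expansion, as functions of the first moment and the variance
  set K : ℝ × ℝ → ℝ := fun x => f x.2 - 1 - ζ * x.1 * dslope f 1 x.2 with hK
  set K' : ℝ → ℝ := fun x => ζ * (dslope f 1 x + 1 / 2) with hK'
  have hqm : Measurable (dslope f 1) := measurable_dslope hfm 1
  have hKm : Measurable K := by fun_prop
  have hKm' : Measurable K' := by fun_prop
  have hqc : ContinuousAt (dslope f 1) 1 := continuousAt_dslope_same.2 hfd.differentiableAt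
  have hq1 : dslope f 1 1 = -1 / 2 := by rw [dslope_same, hfd.deriv]
  have hmv (n : ℕ) : AEMeasurable (fun ω => sampleSecondMoment (fun t => Z t ω) n -
      sampleMean (fun t => Z t ω) n ^ 2) P := (hmb n).sub ((hma n).pow_const 2)
  have hslln : ∀ᵐ ω ∂P, Tendsto (fun n => sampleMean (fun t => Z t ω) n) atTop (𝓝 0) ∧
      Tendsto (fun n => sampleSecondMoment (fun t => Z t ω) n - sampleMean (fun t => Z t ω) n ^ 2)
        atTop (𝓝 1) := by
    filter_upwards [strong_law_ae_real Z (h2.integrable one_le_two)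
      (fun i j hij => hindep.indepFun hij) hident,
      strong_law_ae_real (fun k ω => Z k ω ^ 2) (h4.integrable one_le_two)
      (fun i j hij => hindep2.indepFun hij) hident2] with ω h1 h2
    rw [hmean] at h1
    rw [hsq] at h2
    have h1' : Tendsto (fun n => sampleMean (fun t => Z t ω) n) atTop (𝓝 0) :=
      h1.congr fun n => by rw [sampleMean]; ring
    have h2' : Tendsto (fun n => sampleSecondMoment (fun t => Z t ω) n) atTop (𝓝 1) :=
      h2.congr fun n => by rw [sampleSecondMoment]; ring
    exact ⟨h1', by simpa using h2'.sub (h1'.pow 2)⟩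
  have hKc : ContinuousAt K (0, 1) := by
    have h1 : ContinuousAt (fun x : ℝ × ℝ => f x.2) (0, 1) :=
      ContinuousAt.comp (f := Prod.snd) (g := f) (x := ((0 : ℝ), (1 : ℝ))) hfd.continuousAt
        continuousAt_snd
    have h2 : ContinuousAt (fun x : ℝ × ℝ => dslope f 1 x.2) (0, 1) :=
      ContinuousAt.comp (f := Prod.snd) (g := dslope f 1) (x := ((0 : ℝ), (1 : ℝ))) hqc
        continuousAt_snd
    exact (h1.sub continuousAt_const).sub ((continuousAt_const.mul continuousAt_fst).mul h2)
  have hKc' : ContinuousAt K' 1 := continuousAt_const.mul (hqc.add continuousAt_const)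
  have hK0 : K (0, 1) = 0 := by simp [hK, hf]
  have hK0' : K' 1 = 0 := by
    simp only [hK', hq1]
    ring
  have hcA : TendstoInMeasure P (fun (n : ℕ) ω => K (sampleMean (fun t => Z t ω) n,
      sampleSecondMoment (fun t => Z t ω) n - sampleMean (fun t => Z t ω) n ^ 2))
      atTop (fun _ => 0) := by
    refine tendstoInMeasure_of_tendsto_ae
      (fun n => (hKm.comp_aemeasurable ((hma n).prodMk (hmv n))).aestronglyMeasurable) ?_
    filter_upwards [hslln] with ω hω
    rw [← hK0]
    exact hKc.tendsto.comp (hω.1.prodMk_nhds hω.2)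
  have hcB : TendstoInMeasure P (fun (n : ℕ) ω => K' (sampleSecondMoment (fun t => Z t ω) n -
      sampleMean (fun t => Z t ω) n ^ 2)) atTop (fun _ => 0) := by
    refine tendstoInMeasure_of_tendsto_ae
      (fun n => (hKm'.comp_aemeasurable (hmv n)).aestronglyMeasurable) ?_
    filter_upwards [hslln] with ω hω
    rw [← hK0']
    exact hKc'.tendsto.comp hω.2
  have hmKA (n : ℕ) := hKm.comp_aemeasurable ((hma n).prodMk (hmv n))
  have hmKB (n : ℕ) := hKm'.comp_aemeasurable (hmv n)
  refine ((hA.mul_tendstoInMeasure_zero hcA hmKA).add_of_zero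
    (hB.mul_tendstoInMeasure_zero hcB hmKB)
    (fun n => (hA.forall_aemeasurable n).mul (hmKA n))
    (fun n => (hB.forall_aemeasurable n).mul (hmKB n))).congr_left fun n => ae_of_all _ fun ω => ?_
  exact (sqrt_mul_sharpe_sub_eq ζ (fun t => Z t ω) n).symm

end Linearization

/-! ### The correlation matrix and the asymptotic covariance -/

section CovarianceMatrix

variable {p : ℕ}

lemma correlationMatrix_apply (S : Matrix (Fin p) (Fin p) ℝ) (i j : Fin p) :
    correlationMatrix S i j = S i j / (√(S i i) * √(S j j)) := by
  simp only [correlationMatrix, Matrix.mul_diagonal, Matrix.diagonal_mul]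
  rw [div_eq_mul_inv, mul_inv]
  ring

lemma correlationMatrix_apply_self {S : Matrix (Fin p) (Fin p) ℝ} {i : Fin p} (h : 0 < S i i) :
    correlationMatrix S i i = 1 := by
  rw [correlationMatrix_apply, Real.mul_self_sqrt h.le, div_self h.ne']

lemma sharpeCovariance_apply (R : Matrix (Fin p) (Fin p) ℝ) (ζ : EuclideanSpace ℝ (Fin p))
    (i j : Fin p) : sharpeCovariance R ζ i j = R i j + 1 / 2 * (ζ i * ζ j * R i j ^ 2) := by
  simp only [sharpeCovariance, Matrix.add_apply, Matrix.smul_apply, Matrix.mul_diagonal,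
    Matrix.diagonal_mul, Matrix.hadamard_apply, smul_eq_mul]
  ring

lemma Matrix.PosSemidef.diagonal_mul_mul_diagonal {S : Matrix (Fin p) (Fin p) ℝ}
    (hS : S.PosSemidef) (d : Fin p → ℝ) :
    (Matrix.diagonal d * S * Matrix.diagonal d).PosSemidef := by
  simpa [Matrix.diagonal_conjTranspose] using
    hS.mul_mul_conjTranspose_same (Matrix.diagonal d)

lemma Matrix.PosSemidef.correlationMatrix {S : Matrix (Fin p) (Fin p) ℝ} (hS : S.PosSemidef) :
    (correlationMatrix S).PosSemidef :=
  hS.diagonal_mul_mul_diagonal _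

/-- Positive semidefiniteness of the asymptotic covariance, from the Schur product theorem. -/
lemma Matrix.PosSemidef.sharpeCovariance {R : Matrix (Fin p) (Fin p) ℝ} (hR : R.PosSemidef)
    (ζ : EuclideanSpace ℝ (Fin p)) : (sharpeCovariance R ζ).PosSemidef :=
  hR.add (((hR.hadamard hR).diagonal_mul_mul_diagonal _).smul (by norm_num))

end CovarianceMatrix

/-! ### Standardized coordinates of a Gaussian vector -/

section Standardization

variable {p : ℕ} {μ : EuclideanSpace ℝ (Fin p)} {S : Matrix (Fin p) (Fin p) ℝ}

lemma integral_eval_multivariateGaussian (i : Fin p) :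
    ∫ x, x i ∂multivariateGaussian μ S = μ i := by
  have h := (EuclideanSpace.proj (𝕜 := ℝ) i).integral_comp_id_comm
    (IsGaussian.integrable_id (μ := multivariateGaussian μ S))
  simpa using h

lemma memLp_eval_multivariateGaussian (i : Fin p) :
    MemLp (fun x => x i) 2 (multivariateGaussian μ S) :=
  IsGaussian.memLp_dual _ (EuclideanSpace.proj (𝕜 := ℝ) i) 2 (by simp)

lemma signalNoise_multivariateGaussian (hS : S.PosSemidef) (r : ℝ) (i : Fin p) :
    signalNoise r (multivariateGaussian μ S) i = (μ i - r) / √(S i i) := by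
  have hvar := variance_eq_sub (memLp_eval_multivariateGaussian (μ := μ) (S := S) i)
  rw [variance_eval_multivariateGaussian hS] at hvar
  simp only [Pi.pow_apply] at hvar
  simp only [signalNoise]
  rw [hvar, integral_eval_multivariateGaussian]

/-- The standardization `(x i - μ i) / √(S i i)` of coordinate `i` of a vector `x` with mean `μ` and
covariance matrix `S`. -/
noncomputable def standardize (μ : EuclideanSpace ℝ (Fin p)) (S : Matrix (Fin p) (Fin p) ℝ)
    (i : Fin p) (x : EuclideanSpace ℝ (Fin p)) : ℝ :=
  (x i - μ i) / √(S i i)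

lemma measurable_standardize (i : Fin p) : Measurable (standardize μ S i) := by
  unfold standardize
  fun_prop

variable {Ω : Type*} [MeasurableSpace Ω] {P : Measure Ω} {X : Ω → EuclideanSpace ℝ (Fin p)}

lemma hasGaussianLaw_standardize_prod (hX : HasLaw X (multivariateGaussian μ S) P) (i j : Fin p) :
    HasGaussianLaw (fun ω => (standardize μ S i (X ω), standardize μ S j (X ω))) P := by
  have hsub : HasGaussianLaw (fun ω => X ω - μ) P := by
    have h : HasLaw (fun x => x - μ) ((multivariateGaussian μ S).map fun x => x - μ)
      (multivariateGaussian μ S) := ⟨by fun_prop, rfl⟩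
    exact (h.fun_comp hX).hasGaussianLaw
  have h := hsub.map_fun
    (((√(S i i))⁻¹ • EuclideanSpace.proj (𝕜 := ℝ) i).prod
      ((√(S j j))⁻¹ • EuclideanSpace.proj (𝕜 := ℝ) j))
  simpa [standardize, div_eq_inv_mul] using h

lemma integral_standardize (hX : HasLaw X (multivariateGaussian μ S) P) (i : Fin p) :
    ∫ ω, standardize μ S i (X ω) ∂P = 0 := by
  have h := hX.integral_comp (f := standardize μ S i)
    (measurable_standardize i).aestronglyMeasurable
  simp only [Function.comp_def] at h
  rw [h]
  simp only [standardize]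
  rw [integral_div, integral_sub ((memLp_eval_multivariateGaussian i).integrable one_le_two)
    (integrable_const _), integral_eval_multivariateGaussian]
  simp

lemma integral_standardize_mul (hS : S.PosSemidef) (hX : HasLaw X (multivariateGaussian μ S) P)
    (i j : Fin p) :
    ∫ ω, standardize μ S i (X ω) * standardize μ S j (X ω) ∂P = correlationMatrix S i j := by
  have h := hX.integral_comp (f := fun x => standardize μ S i x * standardize μ S j x)
    ((measurable_standardize i).mul (measurable_standardize j)).aestronglyMeasurable
  simp only [Function.comp_def] at h
  rw [h, correlationMatrix_apply, ← covariance_eval_multivariateGaussian (μ := μ) hS i j,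
    covariance, ← integral_div]
  simp only [integral_eval_multivariateGaussian, standardize, div_mul_div_comm]

end Standardization

/-! ### The influence function of the Sharpe ratio -/

section Influence

variable {Ω : Type*} [MeasurableSpace Ω] {P : Measure Ω} {U V : Ω → ℝ}

lemma ProbabilityTheory.HasGaussianLaw.memLp_sq (hU : HasGaussianLaw U P) :
    MemLp (fun ω => U ω ^ 2) 2 P := by
  rw [memLp_two_iff_integrable_sq (hU.aemeasurable.pow_const 2).aestronglyMeasurable]
  simpa [← pow_mul] using hU.integrable_pow 4

lemma memLp_influence (hU : HasGaussianLaw U P) (a : ℝ) :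
    MemLp (fun ω => U ω - a / 2 * (U ω ^ 2 - 1)) 2 P := by
  have hprob : IsProbabilityMeasure P := hU.isProbabilityMeasure
  exact hU.memLp_two.sub ((hU.memLp_sq.sub (memLp_const 1)).const_mul (a / 2))

lemma integral_influence (hU : HasGaussianLaw U P) (h0 : ∫ ω, U ω ∂P = 0)
    (h2 : ∫ ω, U ω ^ 2 ∂P = 1) (a : ℝ) : ∫ ω, (U ω - a / 2 * (U ω ^ 2 - 1)) ∂P = 0 := by
  have hprob : IsProbabilityMeasure P := hU.isProbabilityMeasure
  have i2 := hU.integrable_pow 2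
  have i3 : Integrable (fun ω => U ω ^ 2 - 1) P := i2.sub (integrable_const _)
  rw [integral_sub hU.integrable (i3.const_mul _),
    integral_const_mul, integral_sub i2 (integrable_const _), h0, h2]
  simp

/-- The covariance of the influence functions of two Sharpe ratios under a standardized Gaussian
pair. The mixed third moments vanish, and `E[U² V²] = 1 + 2 E[U V]²` gives the quadratic term. -/
lemma covariance_influence
    (h : HasGaussianLaw (fun ω => (U ω, V ω)) P) (hU : ∫ ω, U ω ∂P = 0) (hV : ∫ ω, V ω ∂P = 0)
    (hU2 : ∫ ω, U ω ^ 2 ∂P = 1) (hV2 : ∫ ω, V ω ^ 2 ∂P = 1) (a b : ℝ) :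
    cov[fun ω => U ω - a / 2 * (U ω ^ 2 - 1), fun ω => V ω - b / 2 * (V ω ^ 2 - 1); P] =
      (∫ ω, U ω * V ω ∂P) + 1 / 2 * (a * b * (∫ ω, U ω * V ω ∂P) ^ 2) := by
  have hprob : IsProbabilityMeasure P := h.isProbabilityMeasure
  have h' : HasGaussianLaw (fun ω => (V ω, U ω)) P :=
    h.map_fun ((ContinuousLinearMap.snd ℝ ℝ ℝ).prod (ContinuousLinearMap.fst ℝ ℝ ℝ))
  have iUV := h.integrable_mul
  have iVVU := h'.integrable_sq_mul.const_mul (-b / 2)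
  have iUUV := h.integrable_sq_mul.const_mul (-a / 2)
  have iUUVV := h.integrable_sq_mul_sq
  have iU := h.fst.integrable.const_mul (b / 2)
  have iV := h.snd.integrable.const_mul (a / 2)
  have iU2 := h.fst.integrable_pow 2
  have iV2 := h.snd.integrable_pow 2
  have i1 : Integrable (fun _ : Ω => (1 : ℝ)) P := integrable_const _
  have iq1 : Integrable (fun ω => U ω ^ 2 * V ω ^ 2 - U ω ^ 2) P := iUUVV.sub iU2
  have iq2 : Integrable (fun ω => U ω ^ 2 * V ω ^ 2 - U ω ^ 2 - V ω ^ 2) P := iq1.sub iV2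
  have iquad := (iq2.fun_add i1).const_mul (a * b / 4)
  calc cov[fun ω => U ω - a / 2 * (U ω ^ 2 - 1), fun ω => V ω - b / 2 * (V ω ^ 2 - 1); P]
      = ∫ ω, (U ω * V ω + -b / 2 * (V ω ^ 2 * U ω) + -a / 2 * (U ω ^ 2 * V ω) + b / 2 * U ω +
          a / 2 * V ω + a * b / 4 * (U ω ^ 2 * V ω ^ 2 - U ω ^ 2 - V ω ^ 2 + 1)) ∂P := by
        rw [covariance, integral_influence h.fst hU hU2, integral_influence h.snd hV hV2]
        congr with ω
        ring
    _ = _ := by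
        rw [integral_add ((((iUV.fun_add iVVU).fun_add iUUV).fun_add iU).fun_add iV) iquad,
          integral_add (((iUV.fun_add iVVU).fun_add iUUV).fun_add iU) iV,
          integral_add ((iUV.fun_add iVVU).fun_add iUUV) iU,
          integral_add (iUV.fun_add iVVU) iUUV, integral_add iUV iVVU]
        simp only [integral_const_mul]
        rw [integral_add iq2 i1, integral_sub iq1 iV2, integral_sub iUUVV iU2,
          h.integral_sq_mul_sq hU hV, h.integral_sq_mul hU hV, h'.integral_sq_mul hV hU,
          hU, hV, hU2, hV2]
        simp
        ring

end Influence

/-! ### Asymptotic normality of the sample Sharpe ratios -/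

section AsymptoticNormality

/-- Sample Sharpe ratios in terms of the standardized observations. The proof needs
`n ≠ 0`, as the sample mean of a constant is that constant only for nonempty samples. -/
lemma sampleSharpe_apply_of_standardize {p : ℕ} (r : ℝ) {μ : EuclideanSpace ℝ (Fin p)}
    {S : Matrix (Fin p) (Fin p) ℝ} {i : Fin p} (hi : 0 < S i i)
    (x : ℕ → EuclideanSpace ℝ (Fin p)) {n : ℕ} (hn : n ≠ 0) :
    sampleSharpe r x n i =
      ((μ i - r) / √(S i i) + sampleMean (fun t => standardize μ S i (x t)) n) /
      √(sampleSecondMoment (fun t => standardize μ S i (x t)) n -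
        sampleMean (fun t => standardize μ S i (x t)) n ^ 2) := by
  set s := √(S i i) with hs
  have hs0 : 0 < s := Real.sqrt_pos.2 hi
  have hn0 : (n : ℝ) ≠ 0 := Nat.cast_ne_zero.2 hn
  set z : ℕ → ℝ := fun t => standardize μ S i (x t) with hz
  have hx (t : ℕ) : x t i = μ i + s * z t := by
    simp only [hz, standardize, ← hs]
    field_simp
    ring
  have hmean : sampleMean (fun t => x t i) n = μ i + s * sampleMean z n := by
    simp only [sampleMean, hx, Finset.sum_add_distrib, Finset.sum_const, Finset.card_range,
      nsmul_eq_mul, ← Finset.mul_sum]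
    field_simp
  have hsecond : sampleSecondMoment (fun t => x t i) n =
      μ i ^ 2 + 2 * μ i * s * sampleMean z n + s ^ 2 * sampleSecondMoment z n := by
    have hsq (t : ℕ) : x t i ^ 2 = μ i ^ 2 + 2 * μ i * s * z t + s ^ 2 * z t ^ 2 := by
      rw [hx]
      ring
    simp only [sampleSecondMoment, sampleMean, hsq, Finset.sum_add_distrib, Finset.sum_const,
      Finset.card_range, nsmul_eq_mul, ← Finset.mul_sum]
    field_simp
  have hvar : sampleSecondMoment (fun t => x t i) n - sampleMean (fun t => x t i) n ^ 2 =
      s ^ 2 * (sampleSecondMoment z n - sampleMean z n ^ 2) := by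
    rw [hmean, hsecond]
    ring
  simp only [sampleSharpe]
  rw [hvar, hmean, Real.sqrt_mul (sq_nonneg s), Real.sqrt_sq hs0.le, ← div_div]
  congr 1
  field_simp
  ring

lemma aemeasurable_sampleSharpe {Ω : Type*} [MeasurableSpace Ω] {P : Measure Ω} {p : ℕ} (r : ℝ)
    {X : ℕ → Ω → EuclideanSpace ℝ (Fin p)} (hX : ∀ t, AEMeasurable (X t) P) (n : ℕ) :
    AEMeasurable (fun ω => sampleSharpe r (fun t => X t ω) n) P := by
  have hc (t : ℕ) (i : Fin p) : AEMeasurable (fun ω => X t ω i) P :=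
    (by fun_prop : Measurable fun x : EuclideanSpace ℝ (Fin p) => x i).comp_aemeasurable (hX t)
  refine (WithLp.measurable_toLp 2 _).comp_aemeasurable (aemeasurable_pi_lambda _ fun i => ?_)
  have hma : AEMeasurable (fun ω => sampleMean (fun t => X t ω i) n) P :=
    (Finset.aemeasurable_fun_sum _ fun k _ => hc k i).const_mul _
  have hmb : AEMeasurable (fun ω => sampleSecondMoment (fun t => X t ω i) n) P :=
    (Finset.aemeasurable_fun_sum _ fun k _ => (hc k i).pow_const 2).const_mul _
  exact (hma.sub_const r).div (hmb.sub (hma.pow_const 2)).sqrt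

/-- Joint asymptotic normality of the vector of sample Sharpe ratios. -/
theorem tendstoInDistribution_sampleSharpe {Ω : Type*} [MeasurableSpace Ω] {P : Measure Ω}
    [IsProbabilityMeasure P] {p : ℕ} (r : ℝ) {μ : EuclideanSpace ℝ (Fin p)}
    {S : Matrix (Fin p) (Fin p) ℝ} (hS : S.PosSemidef) (hdiag : ∀ i, 0 < S i i)
    {X : ℕ → Ω → EuclideanSpace ℝ (Fin p)}
    (hlaw : ∀ t, HasLaw (X t) (multivariateGaussian μ S) P) (hindep : iIndepFun X P)
    {ζ : EuclideanSpace ℝ (Fin p)} (hζ : ∀ i, ζ i = (μ i - r) / √(S i i)) :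
    TendstoInDistribution
      (fun (n : ℕ) (ω : Ω) => √(n : ℝ) • (sampleSharpe r (fun t => X t ω) n - ζ))
      atTop id (fun _ => P)
      (multivariateGaussian 0 (sharpeCovariance (correlationMatrix S) ζ)) := by
  have hident (k : ℕ) : IdentDistrib (X k) (X 0) P P := (hlaw k).identDistrib (hlaw 0)
  -- the vector of influence functions of the Sharpe ratios, as a function of the observation
  set g : EuclideanSpace ℝ (Fin p) → EuclideanSpace ℝ (Fin p) := fun x =>
    WithLp.toLp 2 fun i => standardize μ S i x - ζ i / 2 * (standardize μ S i x ^ 2 - 1) with hg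
  have hgm : Measurable g := by
    refine (WithLp.measurable_toLp 2 _).comp (measurable_pi_lambda _ fun i => ?_)
    have := measurable_standardize (μ := μ) (S := S) i
    fun_prop
  have hgauss (i : Fin p) : HasGaussianLaw (fun ω => standardize μ S i (X 0 ω)) P :=
    (hasGaussianLaw_standardize_prod (hlaw 0) i i).fst
  have hmean (i : Fin p) := integral_standardize (hlaw 0) i
  have hsq (i : Fin p) : ∫ ω, standardize μ S i (X 0 ω) ^ 2 ∂P = 1 := by
    simp_rw [pow_two]
    rw [integral_standardize_mul hS (hlaw 0), correlationMatrix_apply_self (hdiag i)]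
  have hclt := tendstoInDistribution_inv_sqrt_smul_sum (P := P) (Y := fun k ω => g (X k ω))
    (C := sharpeCovariance (correlationMatrix S) ζ) (hS.correlationMatrix.sharpeCovariance ζ)
    (fun i => memLp_influence (hgauss i) (ζ i))
    (fun i => integral_influence (hgauss i) (hmean i) (hsq i) (ζ i))
    (fun i j => by
      rw [sharpeCovariance_apply, ← integral_standardize_mul hS (hlaw 0) i j]
      exact covariance_influence (hasGaussianLaw_standardize_prod (hlaw 0) i j) (hmean i)
        (hmean j) (hsq i) (hsq j) (ζ i) (ζ j))
    (hindep.comp (fun _ => g) fun _ => hgm) (fun k => (hident k).comp hgm)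
  refine tendstoInDistribution_of_tendstoInMeasure_sub _ _ hclt
    (tendstoInMeasure_zero_of_forall_apply fun i => ?_) fun n =>
      ((aemeasurable_sampleSharpe r (fun t => (hlaw t).aemeasurable) n).sub_const ζ).const_smul
        (√(n : ℝ))
  have hstd := measurable_standardize (μ := μ) (S := S) i
  refine (tendstoInMeasure_sharpe_sub_influence (ζ i) (Z := fun t ω => standardize μ S i (X t ω))
    (hindep.comp (fun _ => standardize μ S i) fun _ => hstd)
    (fun k => (hident k).comp hstd) (hgauss i).memLp_two (hgauss i).memLp_sq
    (hmean i) (hsq i)).congr_left fun n => ae_of_all _ fun ω => ?_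
  rcases eq_or_ne n 0 with rfl | hn
  · simp
  · simp [hg, sampleSharpe_apply_of_standardize (μ := μ) r (hdiag i) _ hn, ← hζ i]

end AsymptoticNormality

theorem mainTheorem2 {Ω : Type*} [MeasurableSpace Ω] (P : Measure Ω) [IsProbabilityMeasure P]
    (p : ℕ) (r : ℝ) (μ : EuclideanSpace ℝ (Fin p)) (S : Matrix (Fin p) (Fin p) ℝ)
    (hS : S.PosSemidef) (hdiag : ∀ i, 0 < S i i)
    (X : ℕ → Ω → EuclideanSpace ℝ (Fin p))
    (hlaw : ∀ t, HasLaw (X t) (multivariateGaussian μ S) P)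
    (hindep : iIndepFun X P)
    (ζ : EuclideanSpace ℝ (Fin p)) (hζ : ζ = signalNoise r (multivariateGaussian μ S))
    (V : Matrix (Fin p) (Fin p) ℝ) (hV : V = sharpeCovariance (correlationMatrix S) ζ) :
    (∀ i, ζ i = (μ i - r) / √(S i i)) ∧
    V.PosSemidef ∧
    TendstoInDistribution
      (fun (n : ℕ) (ω : Ω) => √(n : ℝ) • (sampleSharpe r (fun t => X t ω) n - ζ))
      atTop id (fun _ => P) (multivariateGaussian 0 V) ∧
    (p = 1 → ∀ i,
      (∀ n : ℕ, √(((1 / (n : ℝ)) • V) i i) = √((1 + ζ i ^ 2 / 2) / (n : ℝ))) ∧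
      TendstoInDistribution
        (fun (n : ℕ) (ω : Ω) => √(n : ℝ) * (sampleSharpe r (fun t => X t ω) n i - ζ i))
        atTop id (fun _ => P) (gaussianReal 0 (Real.toNNReal (1 + ζ i ^ 2 / 2)))) := by
  have hζi (i : Fin p) : ζ i = (μ i - r) / √(S i i) := by
    rw [hζ, signalNoise_multivariateGaussian hS]
  have hVpos : V.PosSemidef := hV ▸ hS.correlationMatrix.sharpeCovariance ζ
  have hVdiag (i : Fin p) : V i i = 1 + ζ i ^ 2 / 2 := by
    rw [hV, sharpeCovariance_apply, correlationMatrix_apply_self (hdiag i)]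
    ring
  have hlim : TendstoInDistribution
      (fun (n : ℕ) (ω : Ω) => √(n : ℝ) • (sampleSharpe r (fun t => X t ω) n - ζ))
      atTop id (fun _ => P) (multivariateGaussian 0 V) :=
    hV ▸ tendstoInDistribution_sampleSharpe r hS hdiag hlaw hindep hζi
  refine ⟨hζi, hVpos, hlim, fun _ i => ⟨fun n => ?_, ?_⟩⟩
  · rw [Matrix.smul_apply, hVdiag, smul_eq_mul, one_div_mul_eq_div]
  · have hcoord := measurePreserving_eval_multivariateGaussian (μ := 0) hVpos (i := i)
    rw [hVdiag] at hcoord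
    exact (hlim.continuous_comp (g := fun x : EuclideanSpace ℝ (Fin p) => x i)
      (by fun_prop)).congr_limit (hcoord.hasLaw.identDistrib HasLaw.id)
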